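/- Let $\mathbb D=\{z\in\mathbb C:|z|<1\}$ and let $p:\mathbb D\times[0,\infty)\to\mathbb C$ be such that for each $t\ge 0$ the function $p(\cdot,t)$ is holomorphic in $\mathbb D$ with $p(0,t)=1$ and $\Re p(z,t)>0$ for $z\in\mathbb D$, and for each $z\in\mathbb D$ the function $p(z,\cdot)$ is measurable on $[0,\infty)$. Let $w(z,t)\in\mathbb D$ ($z\in\mathbb D$, $t\ge0$) be the solution of the Loewner–Kufarev equation $$\frac{dw}{d\tau}=-w\,p(w,\tau),\qquad w(z,0)=z,\quad z\in\mathbb D,$$ understood in integral form: $\tau\mapsto w(z,\tau)$ is continuous, $\tau\mapsto w(z,\tau)\,p(w(z,\tau),\tau)$ is integrable on bounded intervals, and $w(z,t)=z-\int_0^t w(z,\tau)\,p(w(z,\tau),\tau)\,d\tau$ for all $t\ge 0$. Suppose there are constants $0<\alpha<1$ and $C_1,C_2>0$ such that, for all $z\in\mathbb D$ and $t\ge 0$, $$\frac{|p(z,t)|}{\Re p(z,t)}\le\frac{C_1}{(1-|z|)^{\alpha}},\qquad \Re p(z,t)\ge C_2(1-|z|)^{\alpha}.$$ Then for every $t\ge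 0$ the map $z\mapsto w(z,t)$ is injective on $\mathbb D$, and its inverse $w(\mathbb D,t)\to\mathbb D$ extends to a continuous function on the closure $\overline{w(\mathbb D,t)}$. -/

import Mathlib

/-- The class of driving functions `p : 𝔻 × [0, ∞) → ℂ`: for every `t ≥ 0` the function `p(·, t)` is
holomorphic on the unit disc with `p(0, t) = 1` and positive real part, and for every `z` in the
disc `p(z, ·)` is (Lebesgue) measurable on `[0, ∞)`. Values outside `𝔻 × [0, ∞)` are irrelevant. -/
structure IsDrivingFunction (p : ℂ → ℝ → ℂ) : Prop where
  holomorphic : ∀ t : ℝ, 0 ≤ t → DifferentiableOn ℂ (fun z => p z t) (Metric.ball 0 1)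
  normalized : ∀ t : ℝ, 0 ≤ t → p 0 t = 1
  re_pos : ∀ z ∈ Metric.ball (0 : ℂ) 1, ∀ t : ℝ, 0 ≤ t → 0 < (p z t).re
  measurable : ∀ z ∈ Metric.ball (0 : ℂ) 1,
    AEMeasurable (p z) (MeasureTheory.volume.restrict (Set.Ici (0 : ℝ)))

/-- `w` solves the Loewner–Kufarev initial value problem `dw/dτ = -w p(w, τ)`, `w(z, 0) = z`,
`z ∈ 𝔻`. As `p` is only measurable in time, the equation is understood in the sense of
Carathéodory, that is, in integral form. -/
structure IsLoewnerKufarevSolution (p : ℂ → ℝ → ℂ) (w : ℂ → ℝ → ℂ) : Prop where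
  mem_disc : ∀ z ∈ Metric.ball (0 : ℂ) 1, ∀ t : ℝ, 0 ≤ t → w z t ∈ Metric.ball (0 : ℂ) 1
  continuousOn : ∀ z ∈ Metric.ball (0 : ℂ) 1, ContinuousOn (w z) (Set.Ici 0)
  integrable : ∀ z ∈ Metric.ball (0 : ℂ) 1, ∀ t : ℝ, 0 ≤ t →
    IntervalIntegrable (fun s => w z s * p (w z s) s) MeasureTheory.volume 0 t
  integral_eq : ∀ z ∈ Metric.ball (0 : ℂ) 1, ∀ t : ℝ, 0 ≤ t →
    w z t = z - ∫ s in (0 : ℝ)..t, w z s * p (w z s) s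

open Set Filter Topology MeasureTheory

/-! The key point is that the inverse of `z ↦ w z t` is uniformly continuous, so it extends to the
closure because `ℂ` is complete. In a disc of radius `1 - η` the field is Lipschitz uniformly in
time, and backward Grönwall carries closeness at time `t` back to earlier times. Near the circle
this bound degenerates, but there the trajectories are short: `‖p‖ / Re p ≤ C (1 - ‖w‖)^(-α)` bounds
the speed by a multiple of the growth rate of `(1 - ‖w‖²)^(1 - α)`, and `α < 1`. The two regimes are
joined at a time when the larger modulus equals `1 - η`. -/

/-- The right-hand side of the Loewner–Kufarev equation is Lipschitz on compact subdiscs, uniformly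
in time. -/
theorem IsDrivingFunction.exists_lipschitz_bound {p : ℂ → ℝ → ℂ} (hp : IsDrivingFunction p)
    {r : ℝ} (hr : r < 1) :
    ∃ L : ℝ, 0 ≤ L ∧ ∀ s : ℝ, 0 ≤ s → ∀ z₁ ∈ Metric.closedBall (0 : ℂ) r,
      ∀ z₂ ∈ Metric.closedBall (0 : ℂ) r, ‖z₂ * p z₂ s - z₁ * p z₁ s‖ ≤ L * ‖z₂ - z₁‖ := by
  -- Since `r + d = 1 - d`, a disc of radius `d` about a point of modulus at most `r` stays where
  -- `bound` applies, so Cauchy's estimate bounds the derivative.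
  set d : ℝ := (1 - r) / 2 with hd
  have hd0 : 0 < d := by linarith
  have bound : ∀ s : ℝ, 0 ≤ s → ∀ z : ℂ, ‖z‖ ≤ 1 - d → ‖z * p z s‖ ≤ 4 / d := by
    intro s hs z hz
    have hz1 : ‖z‖ < 1 := by linarith
    -- `-p` has negative real part; `M = 1` serves because `M` must be positive.
    have h := Complex.borelCaratheodory (f := fun z => -p z s) (M := 1) (R := 1) (z := z) one_pos
      (hp.holomorphic s hs).neg
      (fun x hx => by
        have := hp.re_pos x hx s hs
        simp only [Set.mem_ofPred_eq, Complex.neg_re]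
        linarith) one_pos (by simpa using hz1)
    simp only [norm_neg, hp.normalized s hs, norm_one] at h
    rw [← add_div] at h
    calc ‖z * p z s‖ = ‖z‖ * ‖p z s‖ := norm_mul _ _
      _ ≤ 1 * ‖p z s‖ := by gcongr
      _ ≤ (2 * 1 * ‖z‖ + 1 * (1 + ‖z‖)) / (1 - ‖z‖) := by rw [one_mul]; exact h
      _ ≤ 4 / d := by
        apply div_le_div₀ <;> linarith
  have hdiff : ∀ s : ℝ, 0 ≤ s → DifferentiableOn ℂ (fun z => z * p z s) (Metric.ball 0 1) :=
    fun s hs => differentiableOn_id.mul (hp.holomorphic s hs)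
  refine ⟨4 / d / d, by positivity, fun s hs z₁ hz₁ z₂ hz₂ => ?_⟩
  refine (convex_closedBall (0 : ℂ) r).norm_image_sub_le_of_norm_deriv_le (𝕜 := ℂ)
    (f := fun z => z * p z s) (fun x hx => ?_) (fun x hx => ?_) hz₁ hz₂
  · refine (hdiff s hs).differentiableAt (Metric.isOpen_ball.mem_nhds ?_)
    rw [mem_closedBall_zero_iff] at hx
    rw [mem_ball_zero_iff]
    linarith
  · rw [mem_closedBall_zero_iff] at hx
    have hball : ∀ y ∈ Metric.closedBall x d, ‖y‖ ≤ 1 - d := fun y hy => by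
      have h1 : ‖y - x‖ ≤ d := by simpa [dist_eq_norm] using hy
      have h2 : ‖y‖ ≤ ‖y - x‖ + ‖x‖ := by simpa using norm_add_le (y - x) x
      linarith
    refine Complex.norm_deriv_le_of_forall_mem_sphere_norm_le hd0 ?_
      fun y hy => bound s hs y (hball y (Metric.sphere_subset_closedBall hy))
    refine DifferentiableOn.diffContOnCl ((hdiff s hs).mono fun y hy => ?_)
    rw [mem_ball_zero_iff]
    linarith [hball y (Metric.closure_ball_subset_closedBall hy)]

/-! ### Single trajectories: monotone modulus and length near the circle -/

section Trajectory

variable {p w : ℂ → ℝ → ℂ} {z : ℂ} {t : ℝ}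

theorem IsLoewnerKufarevSolution.initial (hw : IsLoewnerKufarevSolution p w)
    (hz : z ∈ Metric.ball (0 : ℂ) 1) : w z 0 = z := by
  simpa using hw.integral_eq z hz 0 le_rfl

theorem IsLoewnerKufarevSolution.intervalIntegrable (hw : IsLoewnerKufarevSolution p w)
    (hz : z ∈ Metric.ball (0 : ℂ) 1) {a b : ℝ} (ha : 0 ≤ a) (hb : 0 ≤ b) :
    IntervalIntegrable (fun s => w z s * p (w z s) s) volume a b :=
  (hw.integrable z hz a ha).symm.trans (hw.integrable z hz b hb)

theorem IsLoewnerKufarevSolution.sub_eq_integral (hw : IsLoewnerKufarevSolution p w)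
    (hz : z ∈ Metric.ball (0 : ℂ) 1) {a b : ℝ} (ha : 0 ≤ a) (hb : 0 ≤ b) :
    w z a - w z b = ∫ s in a..b, w z s * p (w z s) s := by
  rw [hw.integral_eq z hz a ha, hw.integral_eq z hz b hb,
    ← intervalIntegral.integral_interval_sub_left (hw.integrable z hz b hb)
      (hw.integrable z hz a ha)]
  ring

theorem IsLoewnerKufarevSolution.ae_hasDerivAt (hw : IsLoewnerKufarevSolution p w)
    (hz : z ∈ Metric.ball (0 : ℂ) 1) (ht : 0 ≤ t) :
    ∀ᵐ s, s ∈ Ioo 0 t → HasDerivAt (w z) (-(w z s * p (w z s) s)) s := by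
  filter_upwards [(hw.integrable z hz t ht).ae_hasDerivAt_integral] with s hs hst
  have h := (hs (by rw [uIcc_of_le ht]; exact Ioo_subset_Icc_self hst) 0 (by simp)).const_sub z
  refine h.congr_of_eventuallyEq ?_
  filter_upwards [Ioo_mem_nhds hst.1 hst.2] with x hx
  exact hw.integral_eq z hz x hx.1.le

theorem IsLoewnerKufarevSolution.ae_hasDerivAt_norm_sq (hw : IsLoewnerKufarevSolution p w)
    (hz : z ∈ Metric.ball (0 : ℂ) 1) (ht : 0 ≤ t) :
    ∀ᵐ s, s ∈ Ioo 0 t →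
      HasDerivAt (fun s => ‖w z s‖ ^ 2) (-(2 * ‖w z s‖ ^ 2 * (p (w z s) s).re)) s := by
  filter_upwards [hw.ae_hasDerivAt hz ht] with s hs hst
  convert (hs hst).norm_sq using 1
  rw [Complex.inner, ← Complex.normSq_eq_norm_sq, Complex.normSq_apply]
  simp
  ring

/-- Real and imaginary parts are primitives of integrable functions, and `ρ` is the sum of their
squares. Absolute continuity is what lets the a.e. derivative control increments. -/
theorem IsLoewnerKufarevSolution.exists_absolutelyContinuousOnInterval_eq_norm_sq
    (hw : IsLoewnerKufarevSolution p w) (hz : z ∈ Metric.ball (0 : ℂ) 1) (ht : 0 ≤ t) :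
    ∃ ρ : ℝ → ℝ, AbsolutelyContinuousOnInterval ρ 0 t ∧ ∀ s ∈ Icc 0 t, ρ s = ‖w z s‖ ^ 2 := by
  have hf := hw.integrable z hz t ht
  have hac : ∀ l : ℂ →L[ℝ] ℝ, AbsolutelyContinuousOnInterval
      (fun s => l z - ∫ x in (0 : ℝ)..s, l (w z x * p (w z x) x)) 0 t := fun l =>
    (LipschitzOnWith.absolutelyContinuousOnInterval
      (LipschitzWith.const (l z)).lipschitzOnWith).fun_sub
      (IntervalIntegrable.absolutelyContinuousOnInterval_intervalIntegral
        ⟨l.integrable_comp hf.1, l.integrable_comp hf.2⟩ (by simp))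
  have hval : ∀ s ∈ Icc 0 t, ∀ l : ℂ →L[ℝ] ℝ,
      l z - ∫ x in (0 : ℝ)..s, l (w z x * p (w z x) x) = l (w z s) := fun s hs l => by
    rw [l.intervalIntegral_comp_comm (hw.integrable z hz s hs.1), ← map_sub,
      ← hw.integral_eq z hz s hs.1]
  refine ⟨_, ((hac Complex.reCLM).fun_mul (hac Complex.reCLM)).fun_add
    ((hac Complex.imCLM).fun_mul (hac Complex.imCLM)), fun s hs => ?_⟩
  simp only [hval s hs]
  rw [← Complex.normSq_eq_norm_sq, Complex.normSq_apply, Complex.reCLM_apply, Complex.imCLM_apply]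

theorem IsLoewnerKufarevSolution.antitoneOn_norm_sq (hp : IsDrivingFunction p)
    (hw : IsLoewnerKufarevSolution p w) (hz : z ∈ Metric.ball (0 : ℂ) 1) :
    AntitoneOn (fun s => ‖w z s‖ ^ 2) (Ici 0) := by
  intro a ha b hb hab
  rw [mem_Ici] at ha hb
  obtain ⟨ρ, hρ, heq⟩ := hw.exists_absolutelyContinuousOnInterval_eq_norm_sq hz hb
  have hac : AbsolutelyContinuousOnInterval ρ a b :=
    hρ.mono (uIcc_subset_uIcc (by rw [uIcc_of_le hb]; exact ⟨ha, hab⟩) (by simp))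
  have hint := hac.integral_deriv_eq_sub
  have hle : ∫ s in a..b, deriv ρ s ≤ 0 := by
    rw [intervalIntegral.integral_of_le hab, integral_Ioc_eq_integral_Ioo]
    refine setIntegral_nonpos_of_ae_restrict ?_
    rw [EventuallyLE, ae_restrict_iff' measurableSet_Ioo]
    filter_upwards [hw.ae_hasDerivAt_norm_sq hz hb] with s hs hsab
    have h0s : 0 < s := ha.trans_lt hsab.1
    have hd : HasDerivAt ρ (-(2 * ‖w z s‖ ^ 2 * (p (w z s) s).re)) s := by
      refine (hs ⟨h0s, hsab.2⟩).congr_of_eventuallyEq ?_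
      filter_upwards [Ioo_mem_nhds h0s hsab.2] with x hx using heq x (Ioo_subset_Icc_self hx)
    have hre := hp.re_pos _ (hw.mem_disc z hz s h0s.le) s h0s.le
    rw [hd.deriv, Pi.zero_apply, neg_nonpos]
    positivity
  rw [hint, heq a ⟨ha, hab⟩, heq b ⟨hb, le_rfl⟩] at hle
  exact sub_nonpos.mp hle

theorem IsLoewnerKufarevSolution.antitoneOn_norm (hp : IsDrivingFunction p)
    (hw : IsLoewnerKufarevSolution p w) (hz : z ∈ Metric.ball (0 : ℂ) 1) :
    AntitoneOn (fun s => ‖w z s‖) (Ici 0) := fun _ ha _ hb hab =>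
  le_of_pow_le_pow_left₀ two_ne_zero (norm_nonneg _) (hw.antitoneOn_norm_sq hp hz ha hb hab)

/-- Outside the disc of radius `1 / 2`, the displacement along a trajectory is controlled by the
distance of its endpoint to the unit circle. -/
theorem IsLoewnerKufarevSolution.norm_sub_initial_le (hp : IsDrivingFunction p)
    (hw : IsLoewnerKufarevSolution p w) (hz : z ∈ Metric.ball (0 : ℂ) 1)
    {α C : ℝ} (hα₀ : 0 < α) (hα₁ : α < 1) (hC : 0 < C)
    (hest : ∀ z ∈ Metric.ball (0 : ℂ) 1, ∀ t : ℝ, 0 ≤ t →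
      ‖p z t‖ / (p z t).re ≤ C / (1 - ‖z‖) ^ α)
    (ht : 0 ≤ t) (hnorm : 1 / 2 ≤ ‖w z t‖) :
    ‖z - w z t‖ ≤ 2 * C / (1 - α) * (1 - ‖w z t‖ ^ 2) ^ (1 - α) := by
  set h : ℝ → ℝ := fun s => (1 - ‖w z s‖ ^ 2) ^ (1 - α) with hh
  have hα : 0 < 1 - α := sub_pos.mpr hα₁
  have hlt : ∀ s, 0 ≤ s → ‖w z s‖ < 1 := fun s hs => by simpa using hw.mem_disc z hz s hs
  have hpos : ∀ s, 0 ≤ s → 0 < 1 - ‖w z s‖ ^ 2 := fun s hs => by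
    nlinarith [hlt s hs, norm_nonneg (w z s)]
  have hmono : MonotoneOn h (uIcc 0 t) := by
    rw [uIcc_of_le ht]
    intro a ha b hb hab
    refine Real.rpow_le_rpow (hpos a ha.1).le ?_ hα.le
    have := hw.antitoneOn_norm_sq hp hz ha.1 hb.1 hab
    simp only at this
    linarith
  have hderiv : ∀ᵐ s, s ∈ Ioo 0 t →
      ‖w z s * p (w z s) s‖ ≤ 2 * C / (1 - α) * deriv h s := by
    filter_upwards [hw.ae_hasDerivAt_norm_sq hz ht] with s hs hst
    have h0 := hst.1.le
    have hre := hp.re_pos _ (hw.mem_disc z hz s h0) s h0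
    have hd := ((hs hst).const_sub 1).rpow_const (p := 1 - α) (Or.inl (hpos s h0).ne')
    have hhalf : 1 / 2 ≤ ‖w z s‖ := hnorm.trans (hw.antitoneOn_norm hp hz h0 ht hst.2.le)
    have hest' := hest _ (hw.mem_disc z hz s h0) s h0
    rw [div_le_iff₀ hre] at hest'
    rw [hd.deriv, norm_mul]
    have h1 := hpos s h0
    have h2 := hlt s h0
    -- Uses `1 - x² ≤ 2 (1 - x)` and `2 ^ α ≤ 2`.
    have hpow : 1 / (1 - ‖w z s‖) ^ α ≤ 2 * (1 - ‖w z s‖ ^ 2) ^ (-α) := by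
      have ha : ((1 - ‖w z s‖ ^ 2) / 2) ^ α ≤ (1 - ‖w z s‖) ^ α :=
        Real.rpow_le_rpow (by linarith) (by nlinarith) hα₀.le
      have hb : (1 - ‖w z s‖ ^ 2) ^ α / 2 ≤ ((1 - ‖w z s‖ ^ 2) / 2) ^ α := by
        rw [Real.div_rpow h1.le zero_le_two]
        gcongr
        exact (Real.rpow_le_rpow_of_exponent_le one_le_two hα₁.le).trans_eq (Real.rpow_one 2)
      have hc : 0 < (1 - ‖w z s‖ ^ 2) ^ α := Real.rpow_pos_of_pos h1 α
      rw [Real.rpow_neg h1.le]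
      calc 1 / (1 - ‖w z s‖) ^ α ≤ 1 / ((1 - ‖w z s‖ ^ 2) ^ α / 2) := by
            gcongr
            exact hb.trans ha
        _ = 2 * ((1 - ‖w z s‖ ^ 2) ^ α)⁻¹ := by field_simp
    have hexp : 1 - α - 1 = -α := by ring
    rw [hexp]
    set P := (1 - ‖w z s‖ ^ 2) ^ (-α)
    have hP : 0 < P := Real.rpow_pos_of_pos h1 _
    calc ‖w z s‖ * ‖p (w z s) s‖
        ≤ (2 * ‖w z s‖ ^ 2) * (C * (2 * P) * (p (w z s) s).re) := by
          gcongr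
          · nlinarith
          · refine hest'.trans ?_
            rw [div_eq_mul_one_div]
            gcongr
      _ = 2 * C / (1 - α) * (- -(2 * ‖w z s‖ ^ 2 * (p (w z s) s).re) * (1 - α) * P) := by
          field_simp
  -- For monotone `h`, the integral of `h'` is at most the increment of `h`; absolute continuity of
  -- `h` is not needed.
  have hint := hmono.intervalIntegral_deriv_mem_uIcc
  have h0t : h 0 ≤ h t := hmono (by simp) (by simp) ht
  rw [uIcc_of_le (sub_nonneg.mpr h0t)] at hint
  have hh0 : 0 ≤ h 0 := Real.rpow_nonneg (hpos 0 le_rfl).le _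
  have hsub := hw.sub_eq_integral hz le_rfl ht
  rw [hw.initial hz] at hsub
  calc ‖z - w z t‖ ≤ ∫ s in (0 : ℝ)..t, ‖w z s * p (w z s) s‖ := by
        rw [hsub]
        exact intervalIntegral.norm_integral_le_integral_norm ht
    _ ≤ ∫ s in (0 : ℝ)..t, 2 * C / (1 - α) * deriv h s := by
        refine intervalIntegral.integral_mono_ae_restrict ht (hw.integrable z hz t ht).norm
          (hmono.intervalIntegrable_deriv.const_mul _) ?_
        rw [← restrict_Ioo_eq_restrict_Icc, EventuallyLE, ae_restrict_iff' measurableSet_Ioo]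
        exact hderiv
    _ = 2 * C / (1 - α) * ∫ s in (0 : ℝ)..t, deriv h s :=
        intervalIntegral.integral_const_mul _ _
    _ ≤ 2 * C / (1 - α) * h t := by
        gcongr
        linarith [hint.2]

end Trajectory

/-! ### Grönwall's inequality and extension to the closure -/

/-- Backward Grönwall inequality in integral form. -/
theorem le_mul_exp_of_le_add_integral {u : ℝ → ℝ} {a b δ L : ℝ} (hab : a ≤ b) (hL : 0 ≤ L)
    (hu : ContinuousOn u (Icc a b))
    (h : ∀ s ∈ Icc a b, u s ≤ δ + L * ∫ x in s..b, u x) :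
    u a ≤ δ * Real.exp (L * (b - a)) := by
  have hi : IntervalIntegrable u volume a b := (hu.mono (by rw [uIcc_of_le hab])).intervalIntegrable
  -- `G' = L * exp (L * s) * (δ + L * ∫ x in s..b, u x - u s)`, which the hypothesis makes
  -- nonnegative.
  set G : ℝ → ℝ := fun s => (δ + L * ∫ x in s..b, u x) * Real.exp (L * s) with hG
  have hprim : ContinuousOn (fun s => ∫ x in s..b, u x) (Icc a b) := by
    have := intervalIntegral.continuousOn_primitive_interval_left (f := u) (μ := volume)
      (a := a) (b := b) (by
        rw [uIcc_of_le hab]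
        exact hu.integrableOn_Icc)
    rwa [uIcc_of_le hab] at this
  have hmono : MonotoneOn G (Icc a b) := by
    refine monotoneOn_of_hasDerivWithinAt_nonneg (convex_Icc a b) (by fun_prop)
      (f' := fun s => (L * -u s) * Real.exp (L * s) +
        (δ + L * ∫ x in s..b, u x) * (Real.exp (L * s) * (L * 1))) (fun s hs => ?_)
      (fun s hs => ?_)
    · rw [interior_Icc] at hs
      have hd : HasDerivAt (fun s => ∫ x in s..b, u x) (-u s) s :=
        intervalIntegral.integral_hasDerivAt_left
          (hi.mono_set (uIcc_subset_uIcc (by rw [uIcc_of_le hab]; exact Ioo_subset_Icc_self hs)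
            (by simp)))
          (hu.stronglyMeasurableAtFilter_nhdsWithin measurableSet_Icc s |>.filter_mono
            (by rw [nhdsWithin_eq_nhds.mpr (Icc_mem_nhds hs.1 hs.2)]))
          (hu.continuousAt (Icc_mem_nhds hs.1 hs.2))
      exact (((hd.const_mul L).const_add δ).mul
        (((hasDerivAt_id s).const_mul L).exp)).hasDerivWithinAt
    · rw [interior_Icc] at hs
      have h1 := h s (Ioo_subset_Icc_self hs)
      have : 0 ≤ L * ((δ + L * ∫ x in s..b, u x) - u s) * Real.exp (L * s) :=
        mul_nonneg (mul_nonneg hL (sub_nonneg.mpr h1)) (Real.exp_pos _).le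
      linarith
  have hGab : G a ≤ G b := hmono (left_mem_Icc.mpr hab) (right_mem_Icc.mpr hab) hab
  simp only [hG, intervalIntegral.integral_same, mul_zero, add_zero] at hGab
  have h1 := h a (left_mem_Icc.mpr hab)
  rw [mul_sub, Real.exp_sub, ← mul_div_assoc, le_div_iff₀ (Real.exp_pos _)]
  exact (mul_le_mul_of_nonneg_right h1 (Real.exp_pos _).le).trans hGab

/-- A map whose inverse is uniformly continuous has an inverse which extends continuously to the
closure of its image. -/
theorem exists_continuousOn_closure_leftInvOn {X Y : Type*} [PseudoMetricSpace X] [MetricSpace Y]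
    [CompleteSpace Y] [Nonempty Y] {f : Y → X} {s : Set Y}
    (h : ∀ ε > 0, ∃ δ > 0, ∀ y₁ ∈ s, ∀ y₂ ∈ s, dist (f y₁) (f y₂) < δ → dist y₁ y₂ < ε) :
    ∃ g : X → Y, LeftInvOn g f s ∧ ContinuousOn g (closure (f '' s)) := by
  have hinj : InjOn f s := fun y₁ h₁ y₂ h₂ h12 => by
    refine eq_of_forall_dist_le fun ε hε => ?_
    obtain ⟨δ, hδ, H⟩ := h ε hε
    refine (H y₁ h₁ y₂ h₂ ?_).le
    have : dist (f y₁) (f y₂) = 0 := by rw [h12, dist_self]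
    rwa [this]
  have hleft : LeftInvOn (Function.invFunOn f s) f s := hinj.leftInvOn_invFunOn
  have huc : UniformContinuousOn (Function.invFunOn f s) (f '' s) := by
    rw [Metric.uniformContinuousOn_iff]
    intro ε hε
    obtain ⟨δ, hδ, H⟩ := h ε hε
    refine ⟨δ, hδ, ?_⟩
    rintro _ ⟨y₁, h₁, rfl⟩ _ ⟨y₂, h₂, rfl⟩ h12
    rw [hleft h₁, hleft h₂]
    exact H y₁ h₁ y₂ h₂ h12
  refine ⟨extendFrom (f '' s) (Function.invFunOn f s), fun y hy => ?_,
    continuousOn_extendFrom subset_rfl fun x hx => ?_⟩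
  · rw [extendFrom_extends huc.continuousOn _ (mem_image_of_mem f hy), hleft hy]
  · have := mem_closure_iff_nhdsWithin_neBot.mp hx
    exact cauchy_map_iff_exists_tendsto.mp
      (Cauchy.map_of_le (cauchy_nhds.mono inf_le_left) huc inf_le_right)

/-! ### Uniform continuity of the inverse -/

/-- Trajectories whose endpoints are close start close to each other. -/
theorem IsLoewnerKufarevSolution.exists_dist_initial_lt {p w : ℂ → ℝ → ℂ}
    (hp : IsDrivingFunction p) (hw : IsLoewnerKufarevSolution p w)
    {α C : ℝ} (hα₀ : 0 < α) (hα₁ : α < 1) (hC : 0 < C)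
    (hest : ∀ z ∈ Metric.ball (0 : ℂ) 1, ∀ t : ℝ, 0 ≤ t →
      ‖p z t‖ / (p z t).re ≤ C / (1 - ‖z‖) ^ α)
    {t : ℝ} (ht : 0 ≤ t) {ε : ℝ} (hε : 0 < ε) :
    ∃ δ > 0, ∀ z₁ ∈ Metric.ball (0 : ℂ) 1, ∀ z₂ ∈ Metric.ball (0 : ℂ) 1,
      dist (w z₁ t) (w z₂ t) < δ → dist z₁ z₂ < ε := by
  have hα : 0 < 1 - α := sub_pos.mpr hα₁
  set K := 2 * C / (1 - α)
  have hK : 0 < K := by positivity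
  -- If one modulus is at least `1 - η` and the points are within `η`, both moduli are at least `1 -
  -- 2η`. Then `1 - ‖w‖² ≤ 4η`, and `η ≤ 1 / 4` gives `‖w‖ ≥ 1 / 2`.
  obtain ⟨η, hη0, hη4, hηε⟩ : ∃ η : ℝ, 0 < η ∧ η ≤ 1 / 4 ∧ K * (4 * η) ^ (1 - α) < ε / 4 := by
    have hlim : Tendsto (fun η : ℝ => K * (4 * η) ^ (1 - α)) (𝓝[>] 0) (𝓝 0) := by
      have hc : ContinuousAt (fun η : ℝ => K * (4 * η) ^ (1 - α)) 0 :=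
        ((continuousAt_const.mul continuousAt_id).rpow_const (Or.inr hα.le)).const_mul K
      have := hc.tendsto
      simp only [mul_zero, Real.zero_rpow hα.ne'] at this
      exact this.mono_left nhdsWithin_le_nhds
    have h1 := hlim.eventually_lt_const (show (0 : ℝ) < ε / 4 by positivity)
    have h2 : ∀ᶠ η : ℝ in 𝓝[>] 0, η ∈ Ioc (0 : ℝ) (1 / 4) := Ioc_mem_nhdsGT (by norm_num)
    obtain ⟨η, h1, h2⟩ := (h1.and h2).exists
    exact ⟨η, h2.1, h2.2, h1⟩
  obtain ⟨L, hL, hlip⟩ := hp.exists_lipschitz_bound (r := 1 - η) (by linarith)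
  have hE := Real.exp_pos (L * t)
  refine ⟨min η (ε / 4) / Real.exp (L * t), by positivity, fun z₁ hz₁ z₂ hz₂ hdist => ?_⟩
  rw [lt_div_iff₀ hE, dist_eq_norm] at hdist
  -- Grönwall's inequality while both trajectories stay in the disc of radius `1 - η`
  have hgron : ∀ s ∈ Icc 0 t, (∀ x ∈ Icc s t, s < t → ‖w z₁ x‖ ≤ 1 - η ∧ ‖w z₂ x‖ ≤ 1 - η) →
      ‖w z₁ s - w z₂ s‖ < min η (ε / 4) := by
    intro s hs hin
    refine lt_of_le_of_lt ?_ hdist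
    rcases hs.2.eq_or_lt with rfl | hst
    · exact le_mul_of_one_le_right (norm_nonneg _) (Real.one_le_exp (by positivity))
    have hsub : Icc s t ⊆ Ici 0 := fun x hx => hs.1.trans hx.1
    have hcont : ContinuousOn (fun x => ‖w z₁ x - w z₂ x‖) (Icc s t) :=
      (((hw.continuousOn z₁ hz₁).sub (hw.continuousOn z₂ hz₂)).norm).mono hsub
    refine (le_mul_exp_of_le_add_integral (δ := ‖w z₁ t - w z₂ t‖) hst.le hL hcont
      fun x hx => ?_).trans ?_
    · have hx0 : 0 ≤ x := hsub hx
      have e : w z₁ x - w z₂ x = (w z₁ t - w z₂ t) +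
          ∫ y in x..t, (w z₁ y * p (w z₁ y) y - w z₂ y * p (w z₂ y) y) := by
        rw [intervalIntegral.integral_sub (hw.intervalIntegrable hz₁ hx0 ht)
          (hw.intervalIntegrable hz₂ hx0 ht), ← hw.sub_eq_integral hz₁ hx0 ht,
          ← hw.sub_eq_integral hz₂ hx0 ht]
        ring
      rw [e]
      refine (norm_add_le _ _).trans (add_le_add_right ?_ _)
      rw [← intervalIntegral.integral_const_mul]
      refine intervalIntegral.norm_integral_le_of_norm_le hx.2 (ae_of_all _ fun y hy => ?_) ?_
      · have hy' := hin y ⟨hx.1.trans hy.1.le, hy.2⟩ hst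
        exact hlip y (hx0.trans hy.1.le) _ (by simpa using hy'.2) _ (by simpa using hy'.1)
      · refine ((hcont.mono ?_).intervalIntegrable).const_mul L
        rw [uIcc_of_le hx.2]
        exact Icc_subset_Icc_left hx.1
    · gcongr
      linarith [hs.1]
  -- once a trajectory is close to the circle, both have little length left
  have hclose : ∀ s ∈ Icc 0 t, ‖w z₁ s - w z₂ s‖ < min η (ε / 4) →
      1 - η ≤ max ‖w z₁ s‖ ‖w z₂ s‖ → dist z₁ z₂ < ε := by
    intro s hs hd hmax
    rw [lt_min_iff] at hd
    have hshort : ∀ z ∈ Metric.ball (0 : ℂ) 1, 1 - 2 * η ≤ ‖w z s‖ → ‖z - w z s‖ < ε / 4 := by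
      intro z hz hn
      refine (hw.norm_sub_initial_le hp hz hα₀ hα₁ hC hest hs.1 (by linarith)).trans_lt
        (lt_of_le_of_lt ?_ hηε)
      have hlt : ‖w z s‖ < 1 := by simpa using hw.mem_disc z hz s hs.1
      have : 0 ≤ 1 - ‖w z s‖ ^ 2 := by nlinarith [norm_nonneg (w z s)]
      gcongr
      nlinarith [norm_nonneg (w z s)]
    have h12 := norm_sub_norm_le (w z₁ s) (w z₂ s)
    have h21 := norm_sub_norm_le (w z₂ s) (w z₁ s)
    rw [norm_sub_rev] at h21
    have hn : 1 - 2 * η ≤ ‖w z₁ s‖ ∧ 1 - 2 * η ≤ ‖w z₂ s‖ := by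
      rcases le_max_iff.mp hmax with h | h <;> constructor <;> linarith
    have h1 := hshort z₁ hz₁ hn.1
    have h2 := hshort z₂ hz₂ hn.2
    rw [← dist_eq_norm] at h1 h2 hd
    linarith [dist_triangle4 z₁ (w z₁ s) (w z₂ s) z₂, dist_comm z₂ (w z₂ s)]
  set m : ℝ → ℝ := fun s => max ‖w z₁ s‖ ‖w z₂ s‖ with hm
  have hmanti : AntitoneOn m (Ici 0) := fun a ha b hb hab =>
    max_le_max (hw.antitoneOn_norm hp hz₁ ha hb hab) (hw.antitoneOn_norm hp hz₂ ha hb hab)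
  have hmcont : ContinuousOn m (Icc 0 t) :=
    (ContinuousOn.sup (hw.continuousOn z₁ hz₁).norm (hw.continuousOn z₂ hz₂).norm).mono Icc_subset_Ici_self
  have hm_in : ∀ s ∈ Icc 0 t, m s ≤ 1 - η → ‖w z₁ s - w z₂ s‖ < min η (ε / 4) := fun s hs hms =>
    hgron s hs fun x hx _ => max_le_iff.mp ((hmanti hs.1 (hs.1.trans hx.1) hx.1).trans hms)
  have h0 : (0 : ℝ) ∈ Icc 0 t := left_mem_Icc.mpr ht
  have htt : t ∈ Icc 0 t := right_mem_Icc.mpr ht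
  -- As `m` decreases, either both paths stay inside, or an endpoint is already near the circle, or
  -- `m` crosses `1 - η` at some `s` and Grönwall applies on `[s, t]`.
  rcases le_or_gt (m 0) (1 - η) with hm0 | hm0
  · have h := hm_in 0 h0 hm0
    rw [hw.initial hz₁, hw.initial hz₂, lt_min_iff] at h
    rw [dist_eq_norm]
    linarith [h.2]
  rcases le_or_gt (1 - η) (m t) with hmt | hmt
  · exact hclose t htt (hgron t htt fun _ _ h => absurd h (lt_irrefl t)) hmt
  · obtain ⟨s, hs, hms⟩ := intermediate_value_Icc' ht hmcont ⟨hmt.le, hm0.le⟩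
    exact hclose s hs (hm_in s hs hms.le) hms.ge

theorem theorem1 (p : ℂ → ℝ → ℂ) (hp : IsDrivingFunction p)
    (α C₁ C₂ : ℝ) (hα₀ : 0 < α) (hα₁ : α < 1) (hC₁ : 0 < C₁) (hC₂ : 0 < C₂)
    (hest₁ : ∀ z ∈ Metric.ball (0 : ℂ) 1, ∀ t : ℝ, 0 ≤ t →
      ‖p z t‖ / (p z t).re ≤ C₁ / (1 - ‖z‖) ^ α)
    (hest₂ : ∀ z ∈ Metric.ball (0 : ℂ) 1, ∀ t : ℝ, 0 ≤ t →
      C₂ * (1 - ‖z‖) ^ α ≤ (p z t).re)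
    (w : ℂ → ℝ → ℂ) (hw : IsLoewnerKufarevSolution p w) (t : ℝ) (ht : 0 ≤ t) :
    ∃ g : ℂ → ℂ,
      Set.LeftInvOn g (fun z => w z t) (Metric.ball 0 1) ∧
      ContinuousOn g (closure ((fun z => w z t) '' Metric.ball 0 1)) := by
  exact exists_continuousOn_closure_leftInvOn fun _ hε =>
    hw.exists_dist_initial_lt hp hα₀ hα₁ hC₁ hest₁ ht hε
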